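/- Let $\mathbb{N}=\{1,2,\dots\}$ and $\mathbb{N}_0=\mathbb{N}\cup\{0\}$. An infinite sequence $(e_i)_{i\ge 1}$ in $\mathbb{N}_0$ is called a binomid index if $\sum_{i=n-k+1}^{n} e_i\ge \sum_{i=1}^{k} e_i$ for all integers $1\le k\le n$; a finite sequence $(e_i)_{i\le m}$ in $\mathbb{N}_0$ is called a binomid index of length $m$ if this inequality holds for all $1\le k\le n\le m$. For $k\in\mathbb{N}$ let $\mathbb{I}_k$ be the set of binomid indices of length $k$, and for $\eta\in\mathbb{I}_k$ let $L_k(\eta)$ be the lex-minimal extension of $\eta$, that is, the lexicographically smallest infinite binomid index whose first $k$ entries are $\eta$ (it exists and is unique). Let $\mathbb{L}=\bigcup_{k\in\mathbb{N}}L_k(\mathbb{I}_k)$ be the set of all lex-minimal extensions, and let $\mathbf{Atom}$ be the set of nonzero infinite binomid indices that are not the sum of two nonzero infinite binomid indices. For a set $A$ of sequences, $\langle A\rangle$ denotes the submonoid of $(\mathbb{N}_0)^{\mathbb{N}}$ (under componentwise addition) generated by $A$. Theorem. The set $\mathbb{L}$ is a submonoid of $(\mathbb{N}_0)^{\mathbb{N}}$.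 The submonoids $\langle L_k(\mathbb{I}_k)\rangle$, $k\in\mathbb{N}$, form an increasing chain, each of them is a finitely presented commutative monoid, and $\mathbb{L}$ is the inductive limit of this chain along the inclusions: $\mathbb{L}=\bigcup_{k\in\mathbb{N}}\langle L_k(\mathbb{I}_k)\rangle$, and $\mathbb{L}$ has the universal property of the colimit in the category of commutative monoids. Moreover, the sets $\mathbf{Atom}\cap L_k(\mathbb{I}_k)$, $k\in\mathbb{N}$, are increasing in $k$, and $\langle \mathbf{Atom}\cap L_k(\mathbb{I}_k)\rangle=\langle L_k(\mathbb{I}_k)\rangle$ for every $k\in\mathbb{N}$. -/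

import Mathlib

universe u

namespace Binomid

/-! Sequences are indexed from `0` in the code: an infinite sequence `(e₁, e₂, …)` is the function
`e : ℕ → ℕ` with `e i = e_{i+1}`, and a finite one of length `k` is a function on `Fin k`. -/

/-- Infinite binomid indices: the sum of the `k` entries ending at position `n` is at least
the sum of the first `k` entries, for all `1 ≤ k ≤ n`. -/
def IsBinomid (e : ℕ → ℕ) : Prop :=
  ∀ k n : ℕ, 1 ≤ k → k ≤ n →
    ∑ i ∈ Finset.range k, e i ≤ ∑ i ∈ Finset.Ico (n - k) n, e i

/-- Binomid indices of finite length `m`: the same condition for all `1 ≤ k ≤ n ≤ m`. -/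
def IsFinBinomid {m : ℕ} (μ : Fin m → ℕ) : Prop :=
  ∀ k n : ℕ, 1 ≤ k → k ≤ n → n ≤ m →
    ∑ i : Fin m with i.val < k, μ i ≤ ∑ i : Fin m with n - k ≤ i.val ∧ i.val < n, μ i

/-- The set `𝕀_k` of binomid indices of length `k`. -/
def FinIndex (k : ℕ) : Type := {μ : Fin k → ℕ // IsFinBinomid μ}

/-- The infinite sequence `e` extends the finite sequence `μ`. -/
def Extends {k : ℕ} (e : ℕ → ℕ) (μ : Fin k → ℕ) : Prop := ∀ i : Fin k, e i = μ i

/-- `e` is the lexicographically least infinite binomid index that extends `μ`. -/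
def IsLexMinExt {k : ℕ} (μ : Fin k → ℕ) (e : ℕ → ℕ) : Prop :=
  IsBinomid e ∧ Extends e μ ∧
    ∀ e' : ℕ → ℕ, IsBinomid e' → Extends e' μ → toLex e ≤ toLex e'

/-- Partial sums of the extension of `μ`, used to show that the lex-minimal extension exists. -/
def greedySum {k : ℕ} (μ : Fin k → ℕ) (n : ℕ) : ℕ :=
  if n ≤ k then ∑ i : Fin k with i.val < n, μ i
  else (Finset.Ico 1 n).attach.sup fun i => greedySum μ i.1 + greedySum μ (n - i.1)
termination_by n
decreasing_by
  all_goals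
    have := Finset.mem_Ico.1 i.2
    omega

theorem sum_lt_eq {k : ℕ} (μ : Fin k → ℕ) (e : ℕ → ℕ) (he : Extends e μ) (n : ℕ) (hn : n ≤ k) :
    ∑ i : Fin k with i.val < n, μ i = ∑ i ∈ Finset.range n, e i := by
  have h1 : ∑ i : Fin k with i.val < n, μ i = ∑ i : Fin k with i.val < n, e i :=
    Finset.sum_congr rfl fun i _ => (he i).symm
  rw [h1, Finset.sum_filter, Fin.sum_univ_eq_sum_range (fun i => if i < n then e i else 0) k,
    ← Finset.sum_filter]
  congr 1
  ext i
  simp only [Finset.mem_filter, Finset.mem_range]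
  omega

theorem sum_between_eq {k : ℕ} (μ : Fin k → ℕ) (e : ℕ → ℕ) (he : Extends e μ) (a n : ℕ)
    (hn : n ≤ k) :
    ∑ i : Fin k with a ≤ i.val ∧ i.val < n, μ i = ∑ i ∈ Finset.Ico a n, e i := by
  have h1 : ∑ i : Fin k with a ≤ i.val ∧ i.val < n, μ i
      = ∑ i : Fin k with a ≤ i.val ∧ i.val < n, e i :=
    Finset.sum_congr rfl fun i _ => (he i).symm
  rw [h1, Finset.sum_filter,
    Fin.sum_univ_eq_sum_range (fun i => if a ≤ i ∧ i < n then e i else 0) k, ← Finset.sum_filter]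
  congr 1
  ext i
  simp only [Finset.mem_filter, Finset.mem_range, Finset.mem_Ico]
  omega

theorem isBinomid_iff (e : ℕ → ℕ) : IsBinomid e ↔ ∀ i j : ℕ,
    ∑ l ∈ Finset.range i, e l + ∑ l ∈ Finset.range j, e l ≤ ∑ l ∈ Finset.range (i + j), e l := by
  constructor
  · intro h i j
    rcases Nat.eq_zero_or_pos j with rfl | hj
    · simp
    · have h1 := h j (i + j) hj (by omega)
      have h2 := Finset.sum_range_add_sum_Ico e (show i + j - j ≤ i + j by omega)
      rw [Nat.add_sub_cancel] at h1 h2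
      omega
  · intro h k n _ hkn
    have h1 := h (n - k) k
    have h2 := Finset.sum_range_add_sum_Ico e (show n - k ≤ n by omega)
    rw [Nat.sub_add_cancel hkn] at h1
    omega

theorem greedySum_le {k : ℕ} (μ : Fin k → ℕ) (n : ℕ) (hn : n ≤ k) :
    greedySum μ n = ∑ i : Fin k with i.val < n, μ i := by
  rw [greedySum, if_pos hn]

theorem greedySum_zero {k : ℕ} (μ : Fin k → ℕ) : greedySum μ 0 = 0 := by
  rw [greedySum_le μ 0 (Nat.zero_le _)]
  simp

theorem greedySum_add {k : ℕ} (μ : Fin k → ℕ) (hμ : IsFinBinomid μ) (i j : ℕ) :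
    greedySum μ i + greedySum μ j ≤ greedySum μ (i + j) := by
  rcases Nat.eq_zero_or_pos i with rfl | hi
  · simp [greedySum_zero]
  rcases Nat.eq_zero_or_pos j with rfl | hj
  · simp [greedySum_zero]
  by_cases h : i + j ≤ k
  · rw [greedySum_le μ i (by omega), greedySum_le μ j (by omega), greedySum_le μ _ h]
    let e : ℕ → ℕ := fun l => if h : l < k then μ ⟨l, h⟩ else 0
    have he : Extends e μ := fun l => by simp [e]
    have h1 := hμ j (i + j) hj (by omega) h
    rw [sum_lt_eq μ e he j (by omega), sum_between_eq μ e he _ _ h, Nat.add_sub_cancel] at h1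
    rw [sum_lt_eq μ e he i (by omega), sum_lt_eq μ e he j (by omega), sum_lt_eq μ e he _ h]
    have h2 := Finset.sum_range_add_sum_Ico e (show i ≤ i + j by omega)
    omega
  · have hm : i ∈ Finset.Ico 1 (i + j) := Finset.mem_Ico.2 ⟨hi, by omega⟩
    conv_rhs => rw [greedySum, if_neg h]
    have := Finset.le_sup (f := fun l : {x // x ∈ Finset.Ico 1 (i + j)} =>
      greedySum μ l.1 + greedySum μ (i + j - l.1)) (Finset.mem_attach _ ⟨i, hm⟩)
    simpa using this

theorem exists_isLexMinExt {k : ℕ} (μ : Fin k → ℕ) (hμ : IsFinBinomid μ) :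
    ∃ e : ℕ → ℕ, IsLexMinExt μ e := by
  have hmono : Monotone (greedySum μ) := by
    intro a b hab
    have := greedySum_add μ hμ a (b - a)
    rw [Nat.add_sub_cancel' hab] at this
    omega
  let e : ℕ → ℕ := fun n => greedySum μ (n + 1) - greedySum μ n
  have hsum : ∀ n, ∑ i ∈ Finset.range n, e i = greedySum μ n := by
    intro n
    rw [Finset.sum_range_tsub hmono, greedySum_zero, Nat.sub_zero]
  have hext : Extends e μ := by
    intro i
    let e' : ℕ → ℕ := fun l => if h : l < k then μ ⟨l, h⟩ else 0
    have he : Extends e' μ := fun l => by simp [e']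
    have hi := i.2
    change greedySum μ (i + 1) - greedySum μ i = μ i
    rw [greedySum_le μ _ (by omega), greedySum_le μ _ (by omega), sum_lt_eq μ e' he _ (by omega),
      sum_lt_eq μ e' he _ (by omega), Finset.sum_range_succ, he i]
    omega
  refine ⟨e, ?_, hext, ?_⟩
  · rw [isBinomid_iff]
    intro i j
    simp only [hsum]
    exact greedySum_add μ hμ i j
  · intro e' hb hx
    by_contra hlt
    obtain ⟨n, hn, hlt⟩ := not_le.1 hlt
    have hn' : ∀ j < n, e' j = e j := hn
    have hlt' : e' n < e n := hlt
    have hnk : k ≤ n := by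
      by_contra hc
      have h1 := hx ⟨n, by omega⟩
      have h2 := hext ⟨n, by omega⟩
      simp only at h1 h2
      omega
    have hS : ∀ j ≤ n, ∑ i ∈ Finset.range j, e' i = greedySum μ j := by
      intro j hj
      rw [← hsum]
      exact Finset.sum_congr rfl fun l hl => hn' l (by have := Finset.mem_range.1 hl; omega)
    have hle : greedySum μ (n + 1) ≤ ∑ i ∈ Finset.range (n + 1), e' i := by
      rw [greedySum, if_neg (by omega)]
      refine Finset.sup_le fun l _ => ?_
      have hl := Finset.mem_Ico.1 l.2
      have h1 := (isBinomid_iff e').1 hb l.1 (n + 1 - l.1)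
      rw [Nat.add_sub_cancel' (by omega)] at h1
      rwa [hS _ (by omega), hS _ (by omega)] at h1
    rw [← hsum, Finset.sum_range_succ, Finset.sum_range_succ, hS n le_rfl, hsum] at hle
    omega

theorem isLexMinExt_unique {k : ℕ} {μ : Fin k → ℕ} {e e' : ℕ → ℕ}
    (h : IsLexMinExt μ e) (h' : IsLexMinExt μ e') : e = e' :=
  toLex.injective (le_antisymm (h.2.2 e' h'.1 h'.2.1) (h'.2.2 e h.1 h.2.1))

/-- The map `L_k`, sending a binomid index of length `k` to its lex-minimal extension. -/
noncomputable def L (k : ℕ) (μ : FinIndex k) : ℕ → ℕ :=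
  Classical.choose (exists_isLexMinExt μ.1 μ.2)

theorem L_spec (k : ℕ) (μ : FinIndex k) : IsLexMinExt μ.1 (L k μ) :=
  Classical.choose_spec (exists_isLexMinExt μ.1 μ.2)

/-- The set `𝕃` of all lex-minimal extensions of finite binomid indices. -/
def LexMin : Set (ℕ → ℕ) := {e | ∃ (k : ℕ+) (μ : FinIndex k), e = L k μ}

/-- `Atom`: the nonzero binomid indices that are not a sum of two nonzero binomid indices. -/
def Atom : Set (ℕ → ℕ) :=
  {e | IsBinomid e ∧ e ≠ 0 ∧
    ¬ ∃ e₁ e₂ : ℕ → ℕ, IsBinomid e₁ ∧ IsBinomid e₂ ∧ e₁ ≠ 0 ∧ e₂ ≠ 0 ∧ e = e₁ + e₂}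

/-- The submonoid `⟨L_k(𝕀_k)⟩` of the monoid of sequences under componentwise addition. -/
def spanL (k : ℕ+) : AddSubmonoid (ℕ → ℕ) := AddSubmonoid.closure (Set.range (L k))

/-- A commutative monoid is finitely presented if it is the quotient of a free commutative monoid
of finite rank by the congruence generated by finitely many pairs. -/
def IsFinitelyPresented (M : Type*) [AddCommMonoid M] : Prop :=
  ∃ (n : ℕ) (φ : (Fin n →₀ ℕ) →+ M) (R : Set ((Fin n →₀ ℕ) × (Fin n →₀ ℕ))),
    Function.Surjective φ ∧ R.Finite ∧ addConGen (fun x y => (x, y) ∈ R) = AddCon.ker φ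

/-- `T` is the inductive limit, in commutative monoids, of the submonoids `A k` along the
inclusions: the `A k` lie in `T`, and every family of homomorphisms on the `A k` that is compatible
with the inclusions `A j ⊆ A k` for `j ≤ k` factors through a unique homomorphism on `T`. -/
def IsInductiveLimit {M ι : Type*} [AddCommMonoid M] [Preorder ι]
    (A : ι → AddSubmonoid M) (T : AddSubmonoid M) : Prop :=
  ∃ hT : ∀ k, A k ≤ T, ∀ (N : Type u) [AddCommMonoid N] (f : ∀ k, A k →+ N),
    (∀ j k, j ≤ k → ∀ (x : M) (hj : x ∈ A j) (hk : x ∈ A k), f k ⟨x, hk⟩ = f j ⟨x, hj⟩) →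
    ∃! g : T →+ N, ∀ (k : ι) (x : A k), g (AddSubmonoid.inclusion (hT k) x) = f k x

end Binomid

/-!
A sequence is a binomid index exactly when its partial sums `S` are superadditive, and it is the
lex-minimal extension of its first `k` entries exactly when moreover each `S n` with `n > k` equals
some `S i + S (n - i)` with `0 < i < n`: otherwise `S n` could be lowered by one. This splitting
condition passes to summands, so every element of `L_k(𝕀_k)` is a sum of atoms in `L_k(𝕀_k)`.

It is not closed under addition, but it implies `S (n + d) = S n + S d` for `n ≥ k²`, where `d ≤ k`
maximizes `S d / d`, and hence the same identity with the common period `k!` in place of `d`. This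
identity is additive in `S` and in turn implies the splitting condition after `k² + k!`, so
`⟨L_k(𝕀_k)⟩` lies in `L_m(𝕀_m)` with `m = k² + k!`.

The defects `S (i + j) - S i - S j` of such quasi-periodic sequences are determined by finitely many
of them, and `a` is a summand of `b` as soon as the first entry and the defects of `a` are at most
those of `b`. By Dickson's lemma `L_k(𝕀_k)` contains only finitely many atoms, so `⟨L_k(𝕀_k)⟩` is
finitely generated, and finitely presented by Rédei's theorem.
-/

namespace Binomid

section FinitePresentation

theorem addConGen_of_single_sub_single_mem_span {k A : Type*} [CommRing k] [Nontrivial k]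
    [AddCommMonoid A] {R : Set (A × A)} {x y : A}
    (h : AddMonoidAlgebra.single x (1 : k) - AddMonoidAlgebra.single y 1 ∈
      Ideal.span ((fun p : A × A => AddMonoidAlgebra.single p.1 (1 : k) -
        AddMonoidAlgebra.single p.2 1) '' R)) :
    addConGen (fun x y => (x, y) ∈ R) x y := by
  set c := addConGen fun x y => (x, y) ∈ R
  let π : AddMonoidAlgebra k A →+* AddMonoidAlgebra k c.Quotient :=
    AddMonoidAlgebra.mapDomainRingHom k c.mk'
  have π_eq_zero_iff (x y : A) :
      π (AddMonoidAlgebra.single x 1 - AddMonoidAlgebra.single y 1) = 0 ↔ c x y := by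
    simp only [π, map_sub, AddMonoidAlgebra.mapDomainRingHom_apply,
      AddMonoidAlgebra.mapDomain_single, sub_eq_zero,
      AddMonoidAlgebra.single_left_inj (one_ne_zero (α := k))]
    exact AddCon.eq c
  have span_le : Ideal.span ((fun p : A × A => AddMonoidAlgebra.single p.1 (1 : k) -
      AddMonoidAlgebra.single p.2 1) '' R) ≤ RingHom.ker π := by
    rw [Ideal.span_le]
    rintro _ ⟨p, hp, rfl⟩
    exact (π_eq_zero_iff p.1 p.2).2 (AddConGen.Rel.of _ _ hp)
  exact (π_eq_zero_iff x y).1 (span_le h)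

/-- **Rédei's theorem**, deduced from the Noetherianity of the monoid algebra `ℤ[A]`. -/
theorem exists_finite_addConGen_eq {A : Type*} [AddCommMonoid A] [AddMonoid.FG A] (c : AddCon A) :
    ∃ R : Set (A × A), R.Finite ∧ addConGen (fun x y => (x, y) ∈ R) = c := by
  classical
  have : IsNoetherianRing (AddMonoidAlgebra ℤ A) := Algebra.FiniteType.isNoetherianRing ℤ _
  let δ : A × A → AddMonoidAlgebra ℤ A := fun p =>
    AddMonoidAlgebra.single p.1 1 - AddMonoidAlgebra.single p.2 1
  let K : Set (A × A) := {p | c p.1 p.2}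
  obtain ⟨_, hK, span_eq⟩ := (Submodule.fg_span_iff_fg_span_finset_subset (δ '' K)).1
    (IsNoetherian.noetherian (Ideal.span (δ '' K)))
  obtain ⟨R, hRK, rfl⟩ := Finset.subset_set_image_iff.1 hK
  refine ⟨R, R.finite_toSet, le_antisymm (AddCon.addConGen_le.2 fun x y hxy => hRK hxy)
    fun x y hxy => addConGen_of_single_sub_single_mem_span (k := ℤ) ?_⟩
  rw [Finset.coe_image] at span_eq
  exact span_eq.le (Submodule.subset_span ⟨(x, y), hxy, rfl⟩)

theorem isFinitelyPresented_of_fg (M : Type*) [AddCommMonoid M] [AddMonoid.FG M] :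
    IsFinitelyPresented M := by
  have : Module.Finite ℕ M := Module.Finite.iff_addMonoid_fg.2 inferInstance
  obtain ⟨n, f, hf⟩ := Module.Finite.exists_fin' ℕ M
  let φ : (Fin n →₀ ℕ) →+ M :=
    (f.comp (Finsupp.linearEquivFunOnFinite ℕ ℕ (Fin n)).toLinearMap).toAddMonoidHom
  have hφ : Function.Surjective φ :=
    hf.comp (Finsupp.linearEquivFunOnFinite ℕ ℕ (Fin n)).surjective
  have : AddMonoid.FG (Fin n →₀ ℕ) := Module.Finite.iff_addMonoid_fg.1 inferInstance
  obtain ⟨R, hR, hRφ⟩ := exists_finite_addConGen_eq (AddCon.ker φ)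
  exact ⟨n, φ, R, hφ, hR, hRφ⟩

end FinitePresentation

theorem isInductiveLimit_iSup {M ι : Type*} [AddCommMonoid M] [Preorder ι] [IsDirectedOrder ι]
    [Nonempty ι] {A : ι → AddSubmonoid M} (hA : Monotone A) :
    IsInductiveLimit.{u} A (⨆ k, A k) := by
  refine ⟨le_iSup A, fun N _ f hf => ?_⟩
  have compatible (j k : ι) (x : M) (hj : x ∈ A j) (hk : x ∈ A k) :
      f j ⟨x, hj⟩ = f k ⟨x, hk⟩ := by
    obtain ⟨l, hjl, hkl⟩ := exists_ge_ge j k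
    rw [← hf j l hjl x hj (hA hjl hj), hf k l hkl x hk (hA hjl hj)]
  have coe_iSup := AddSubmonoid.coe_iSup_of_directed hA.directed_le
  let g : (⨆ k, A k : AddSubmonoid M) → N :=
    Set.iUnionLift (fun k => (A k : Set M)) (fun k => f k) compatible _ coe_iSup.le
  have g_apply (x : (⨆ k, A k : AddSubmonoid M)) {k : ι} (hx : (x : M) ∈ A k) :
      g x = f k ⟨x, hx⟩ :=
    Set.iUnionLift_of_mem (S := fun k => (A k : Set M)) x hx
  have g_add (x y : (⨆ k, A k : AddSubmonoid M)) : g (x + y) = g x + g y := by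
    obtain ⟨j, hx⟩ := Set.mem_iUnion.1 (coe_iSup.le x.2)
    obtain ⟨k, hy⟩ := Set.mem_iUnion.1 (coe_iSup.le y.2)
    obtain ⟨l, hjl, hkl⟩ := exists_ge_ge j k
    rw [g_apply x (hA hjl hx), g_apply y (hA hkl hy), ← map_add]
    exact g_apply (x + y) (add_mem (hA hjl hx) (hA hkl hy))
  have g_zero : g 0 = 0 :=
    (g_apply 0 (zero_mem (A (Classical.arbitrary ι)))).trans (map_zero _)
  refine ⟨⟨⟨g, g_zero⟩, g_add⟩, fun k x => g_apply _ x.2, fun g' hg' => ?_⟩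
  ext x
  obtain ⟨k, hx⟩ := Set.mem_iUnion.1 (coe_iSup.le x.2)
  exact (hg' k ⟨x, hx⟩).trans (g_apply x hx).symm

theorem exists_le_map_sum_eq_zero {ι G : Type*} [AddCommGroup G] [Finite G] (f : ι → G)
    {s : Multiset ι} (hs : Nat.card G ≤ s.card) : ∃ t ≤ s, t ≠ 0 ∧ (t.map f).sum = 0 := by
  have := Fintype.ofFinite G
  induction s using Quotient.inductionOn with | _ l
  replace hs : Fintype.card G < Fintype.card (Fin (l.length + 1)) := by
    simpa [Nat.lt_succ_iff, Nat.card_eq_fintype_card] using hs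
  obtain ⟨i, j, hij, heq⟩ : ∃ i j : Fin (l.length + 1), i < j ∧
      ((l.take i).map f).sum = ((l.take j).map f).sum := by
    obtain ⟨i, j, hne, heq⟩ := Fintype.exists_ne_map_eq_of_card_lt
      (fun i : Fin (l.length + 1) => ((l.take i).map f).sum) hs
    rcases hne.lt_or_gt with h | h
    · exact ⟨i, j, h, heq⟩
    · exact ⟨j, i, h, heq.symm⟩
  have hlen : ((l.drop i).take (j - i)).length = j - i := by grind
  refine ⟨(l.drop i).take (j - i),
    Multiset.coe_le.2 ((List.take_sublist _ _).trans (List.drop_sublist _ _)).subperm, ?_, ?_⟩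
  · rw [Ne, Multiset.coe_eq_zero, ← List.length_eq_zero_iff, hlen]
    omega
  · have : l.take j = l.take i ++ (l.drop i).take (j - i) := by
      rw [← List.take_add, Nat.add_sub_cancel' hij.le]
    rw [this, List.map_append, List.sum_append, left_eq_add] at heq
    exact heq

theorem exists_le_dvd_sum {d : ℕ} (hd : 0 < d) {s : Multiset ℕ} (hs : d ≤ s.card) :
    ∃ t ≤ s, t ≠ 0 ∧ d ∣ t.sum := by
  have : NeZero d := ⟨hd.ne'⟩
  obtain ⟨t, hts, ht, hsum⟩ := exists_le_map_sum_eq_zero (fun i : ℕ => (i : ZMod d)) (s := s)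
    (by rwa [Nat.card_zmod])
  refine ⟨t, hts, ht, (ZMod.natCast_eq_zero_iff _ _).1 ?_⟩
  rwa [Nat.cast_multiset_sum]

section Splitting

variable {M : Type*} [AddCommMonoid M] {S : ℕ → M} {k : ℕ}

/-- Every value of `S` beyond position `k` is the sum of the values at two smaller positive
positions. -/
def SplitsAfter (k : ℕ) (S : ℕ → M) : Prop :=
  ∀ n, k < n → ∃ i j, 0 < i ∧ 0 < j ∧ i + j = n ∧ S n = S i + S j

/-- `S` is additively periodic of period `d` from position `N` on: advancing the argument by `d`
adds the constant `S d`, and not just some constant. -/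
def IsQuasiperiodic (N d : ℕ) (S : ℕ → M) : Prop :=
  ∀ n, N ≤ n → S (n + d) = S n + S d

theorem SplitsAfter.mono {j : ℕ} (hS : SplitsAfter j S) (hjk : j ≤ k) : SplitsAfter k S :=
  fun n hn => hS n (hjk.trans_lt hn)

theorem SplitsAfter.eq_zero (hS : SplitsAfter k S) (h0 : ∀ n ≤ k, S n = 0) : S = 0 := by
  funext n
  induction n using Nat.strong_induction_on with
  | _ n ih =>
    by_cases hn : n ≤ k
    · exact h0 n hn
    · obtain ⟨i, j, hi, hj, rfl, split⟩ := hS n (not_le.1 hn)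
      rw [split, ih i (by omega), ih j (by omega)]
      exact add_zero 0

theorem SplitsAfter.exists_parts (hS : SplitsAfter k S) (h0 : S 0 = 0) (n : ℕ) :
    ∃ s : Multiset ℕ, (∀ p ∈ s, 0 < p ∧ p ≤ k) ∧ s.sum = n ∧ (s.map S).sum = S n := by
  induction n using Nat.strong_induction_on with
  | _ n ih =>
    rcases Nat.eq_zero_or_pos n with rfl | hn
    · exact ⟨0, by simp, rfl, h0.symm⟩
    by_cases hnk : n ≤ k
    · exact ⟨{n}, by simp [hn, hnk], by simp, by simp⟩
    obtain ⟨i, j, hi, hj, rfl, split⟩ := hS n (not_le.1 hnk)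
    obtain ⟨s, hs, hsi, hSi⟩ := ih i (by omega)
    obtain ⟨t, ht, htj, hSj⟩ := ih j (by omega)
    refine ⟨s + t, fun p hp => (Multiset.mem_add.1 hp).elim (hs p) (ht p), ?_, ?_⟩
    · rw [Multiset.sum_add, hsi, htj]
    · rw [Multiset.map_add, Multiset.sum_add, hSi, hSj, split]

theorem IsQuasiperiodic.splitsAfter {N d : ℕ} (hS : IsQuasiperiodic N d S) (hd : 0 < d) :
    SplitsAfter (N + d) S := fun n hn => by
  obtain ⟨m, rfl⟩ := Nat.exists_eq_add_of_le' (show d ≤ n by omega)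
  exact ⟨m, d, by omega, hd, rfl, hS m (by omega)⟩

theorem IsQuasiperiodic.add {N d : ℕ} {T : ℕ → M} (hS : IsQuasiperiodic N d S)
    (hT : IsQuasiperiodic N d T) : IsQuasiperiodic N d (S + T) := fun n hn => by
  simp only [Pi.add_apply, hS n hn, hT n hn, add_add_add_comm]

theorem IsQuasiperiodic.apply_add_mul {N d : ℕ} (hS : IsQuasiperiodic N d S) (q : ℕ) {n : ℕ}
    (hn : N ≤ n) : S (n + q * d) = S n + q • S d := by
  induction q with
  | zero => simp
  | succ q ih =>
    rw [add_mul, one_mul, ← add_assoc, hS _ (by omega), ih, succ_nsmul, add_assoc]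

end Splitting

section Superadditive

variable {M : Type*} [AddCommMonoid M]

/-- Superadditive sequences, indexed from `0` and normalized by `S 0 = 0`. -/
structure Superadditive [LE M] (S : ℕ → M) : Prop where
  map_zero : S 0 = 0
  add_le (i j : ℕ) : S i + S j ≤ S (i + j)

section PartialOrder

variable [PartialOrder M] {S T : ℕ → M}

theorem Superadditive.add [IsOrderedAddMonoid M] (hS : Superadditive S) (hT : Superadditive T) :
    Superadditive (S + T) where
  map_zero := by simp [hS.map_zero, hT.map_zero]
  add_le i j := by
    simpa only [Pi.add_apply, add_add_add_comm] using add_le_add (hS.add_le i j) (hT.add_le i j)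

theorem Superadditive.sum_map_le [IsOrderedAddMonoid M] (hS : Superadditive S) (s : Multiset ℕ) :
    (s.map S).sum ≤ S s.sum := by
  induction s using Multiset.induction with
  | empty => simp [hS.map_zero]
  | cons i s ih =>
    rw [Multiset.map_cons, Multiset.sum_cons, Multiset.sum_cons]
    exact (add_le_add_right ih _).trans (hS.add_le i s.sum)

theorem Superadditive.nsmul_le [IsOrderedAddMonoid M] (hS : Superadditive S) (q d : ℕ) :
    q • S d ≤ S (q * d) := by
  simpa using hS.sum_map_le (Multiset.replicate q d)

theorem SplitsAfter.of_add_left [IsOrderedCancelAddMonoid M] {k : ℕ}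
    (h : SplitsAfter k (S + T)) (hS : Superadditive S) (hT : Superadditive T) :
    SplitsAfter k S := by
  intro n hn
  obtain ⟨i, j, hi, hj, rfl, split⟩ := h n hn
  refine ⟨i, j, hi, hj, rfl, 
    le_antisymm (le_of_add_le_add_right (a := T (i + j)) ?_) (hS.add_le i j)⟩
  calc S (i + j) + T (i + j) = S i + S j + (T i + T j) := split.trans (add_add_add_comm _ _ _ _)
    _ ≤ S i + S j + T (i + j) := add_le_add_right (hT.add_le i j) _

theorem IsQuasiperiodic.mul_left [IsOrderedAddMonoid M] {N d : ℕ} (h : IsQuasiperiodic N d S)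
    (hS : Superadditive S) (q : ℕ) : IsQuasiperiodic N (q * d) S := fun n hn =>
  le_antisymm ((h.apply_add_mul q hn).trans_le (add_le_add_right (hS.nsmul_le q d) _))
    (hS.add_le n (q * d))

end PartialOrder

section LinearOrder

variable [LinearOrder M] [IsOrderedCancelAddMonoid M] {S : ℕ → M} {k : ℕ}

theorem exists_max_slope (S : ℕ → M) (hk : 0 < k) :
    ∃ d, 0 < d ∧ d ≤ k ∧ ∀ n, 0 < n → n ≤ k → d • S n ≤ n • S d := by
  induction k, hk using Nat.le_induction with
  | base => exact ⟨1, one_pos, le_rfl, fun n hn hn1 => by rw [le_antisymm hn1 hn]⟩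
  | succ k hk ih =>
    obtain ⟨d, hd, hdk, hmax⟩ := ih
    rcases le_total (d • S (k + 1)) ((k + 1) • S d) with hle | hle
    · refine ⟨d, hd, by omega, fun n hn hnk => ?_⟩
      rcases Nat.le_succ_iff.1 hnk with h | rfl
      exacts [hmax n hn h, hle]
    · refine ⟨k + 1, by omega, le_rfl, fun n hn hnk => ?_⟩
      rcases Nat.le_succ_iff.1 hnk with h | rfl
      · refine le_of_nsmul_le_nsmul_right hd.ne' ?_
        calc d • (k + 1) • S n = (k + 1) • d • S n := smul_comm _ _ _
          _ ≤ (k + 1) • n • S d := nsmul_le_nsmul_right (hmax n hn h) _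
          _ = n • (k + 1) • S d := smul_comm _ _ _
          _ ≤ n • d • S (k + 1) := nsmul_le_nsmul_right hle _
          _ = d • n • S (k + 1) := smul_comm _ _ _
      · exact le_rfl

theorem sum_map_le_nsmul_of_max_slope {d q : ℕ} (hd : 0 < d) {t : Multiset ℕ}
    (hmax : ∀ p ∈ t, d • S p ≤ p • S d) (ht : t.sum = q * d) : (t.map S).sum ≤ q • S d := by
  refine le_of_nsmul_le_nsmul_right hd.ne' ?_
  calc d • (t.map S).sum = (t.map fun p => d • S p).sum := Multiset.sum_map_nsmul.symm
    _ ≤ (t.map fun p => p • S d).sum := Multiset.sum_map_le_sum_map _ _ hmax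
    _ = d • q • S d := by rw [← Multiset.sum_smul, ht, mul_nsmul]

/-- Split `n + d` into parts of size at most `k`. As `n ≥ k * k`, there are at least `d` parts, so
some of them add up to a multiple of `d`; trading those for copies of `d`, a position of maximal
slope, does not decrease the sum of the values. -/
theorem Superadditive.exists_isQuasiperiodic (hS : Superadditive S) (hk : 0 < k)
    (h : SplitsAfter k S) : ∃ d, 0 < d ∧ d ≤ k ∧ IsQuasiperiodic (k * k) d S := by
  obtain ⟨d, hd, hdk, hmax⟩ := exists_max_slope S hk
  refine ⟨d, hd, hdk, fun n hn => le_antisymm ?_ (hS.add_le n d)⟩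
  obtain ⟨s, hs, hsum, hSsum⟩ := h.exists_parts hS.map_zero (n + d)
  have card_le : d ≤ s.card := by
    have : s.sum ≤ s.card * k := s.sum_le_card_nsmul k fun p hp => (hs p hp).2
    nlinarith
  obtain ⟨t, hts, ht0, htd⟩ := exists_le_dvd_sum hd card_le
  obtain ⟨u, rfl⟩ := Multiset.le_iff_exists_add.1 hts
  obtain ⟨q, hq⟩ : ∃ q, t.sum = (q + 1) * d := by
    obtain ⟨q, hq⟩ := htd
    obtain ⟨p, hp⟩ := Multiset.exists_mem_of_ne_zero ht0
    have : 0 < p := (hs p (Multiset.mem_add.2 (.inl hp))).1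
    have : p ≤ t.sum := Multiset.le_sum_of_mem hp
    obtain ⟨q, rfl⟩ := Nat.exists_eq_succ_of_ne_zero (show q ≠ 0 by rintro rfl; omega)
    exact ⟨q, by rw [hq, mul_comm]⟩
  have ht : (t.map S).sum ≤ (q + 1) • S d := sum_map_le_nsmul_of_max_slope hd
    (fun p hp => (hs p (Multiset.mem_add.2 (.inl hp))).elim (hmax p)) hq
  have hn : q * d + u.sum = n := by
    rw [Multiset.sum_add, hq] at hsum
    linarith
  calc S (n + d) = (t.map S).sum + (u.map S).sum := by
        rw [← hSsum, Multiset.map_add, Multiset.sum_add]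
    _ ≤ (q + 1) • S d + S u.sum := add_le_add ht (hS.sum_map_le u)
    _ = q • S d + S u.sum + S d := by rw [succ_nsmul, add_right_comm]
    _ ≤ S (q * d) + S u.sum + S d := by gcongr; exact hS.nsmul_le q d
    _ ≤ S n + S d := by gcongr; exact hn ▸ hS.add_le _ _

theorem Superadditive.isQuasiperiodic_factorial (hS : Superadditive S) (hk : 0 < k)
    (h : SplitsAfter k S) : IsQuasiperiodic (k * k) k.factorial S := by
  obtain ⟨d, hd, hdk, hSd⟩ := hS.exists_isQuasiperiodic hk h
  obtain ⟨q, hq⟩ := Nat.dvd_factorial hd hdk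
  rw [hq, mul_comm d q]
  exact hSd.mul_left hS q

end LinearOrder

end Superadditive

section PartialSums

/-- The partial sums of a sequence, as an additive map; `psum e n` is the sum of the first `n`
entries of `e`. -/
def psum : (ℕ → ℕ) →+ ℕ → ℕ where
  toFun e n := ∑ i ∈ Finset.range n, e i
  map_zero' := by ext; simp
  map_add' e e' := by ext; simp [Finset.sum_add_distrib]

variable {e e' : ℕ → ℕ}

theorem psum_zero_right (e : ℕ → ℕ) : psum e 0 = 0 :=
  Finset.sum_range_zero e

theorem psum_succ (e : ℕ → ℕ) (n : ℕ) : psum e (n + 1) = psum e n + e n :=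
  Finset.sum_range_succ e n

theorem psum_mono (e : ℕ → ℕ) : Monotone (psum e) :=
  monotone_nat_of_le_succ fun n => (Nat.le_add_right _ _).trans_eq (psum_succ e n).symm

theorem forall_psum_eq_iff {n : ℕ} :
    (∀ m ≤ n, psum e' m = psum e m) ↔ ∀ i < n, e' i = e i := by
  refine ⟨fun h i hi => ?_, fun h m hm => Finset.sum_congr rfl fun i hi =>
    h i ((Finset.mem_range.1 hi).trans_le hm)⟩
  have := h (i + 1) hi
  rwa [psum_succ, psum_succ, h i hi.le, Nat.add_left_cancel_iff] at this

theorem psum_injective : Function.Injective psum := fun _ _ h =>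
  funext fun i => forall_psum_eq_iff.1 (fun m _ => congrFun h m) i i.lt_succ_self

theorem toLex_lt_toLex_iff_psum : toLex e' < toLex e ↔
    ∃ n, (∀ m ≤ n, psum e' m = psum e m) ∧ psum e' (n + 1) < psum e (n + 1) := by
  change (∃ n, (∀ i < n, e' i = e i) ∧ e' n < e n) ↔ _
  refine exists_congr fun n => ?_
  rw [← forall_psum_eq_iff, psum_succ, psum_succ]
  exact and_congr_right fun h => by rw [h n le_rfl, Nat.add_lt_add_iff_left]

theorem isBinomid_iff_superadditive : IsBinomid e ↔ Superadditive (psum e) :=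
  (isBinomid_iff e).trans ⟨fun h => ⟨psum_zero_right e, h⟩, fun h => h.add_le⟩

theorem Superadditive.exists_isBinomid {S : ℕ → ℕ} (hS : Superadditive S) :
    ∃ e, IsBinomid e ∧ psum e = S := by
  have mono : Monotone S :=
    monotone_nat_of_le_succ fun n => (Nat.le_add_right _ _).trans (hS.add_le n 1)
  have psum_eq : psum (fun n => S (n + 1) - S n) = S := funext fun n =>
    (Finset.sum_range_tsub mono n).trans (by rw [hS.map_zero, Nat.sub_zero])
  exact ⟨_, isBinomid_iff_superadditive.2 (psum_eq.symm ▸ hS), psum_eq⟩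

theorem IsBinomid.add (h : IsBinomid e) (h' : IsBinomid e') : IsBinomid (e + e') := by
  rw [isBinomid_iff_superadditive] at h h' ⊢
  rw [map_add]
  exact h.add h'

theorem isBinomid_zero : IsBinomid 0 := fun _ _ _ _ => by simp

theorem IsBinomid.restrict (h : IsBinomid e) (k : ℕ) :
    IsFinBinomid fun i : Fin k => e i := fun m n hm hmn hnk => by
  rw [sum_lt_eq _ e (fun _ => rfl) m (hmn.trans hnk), sum_between_eq _ e (fun _ => rfl) _ n hnk]
  exact h m n hm hmn

end PartialSums

section LexMinimal

variable {e : ℕ → ℕ} {k : ℕ}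

theorem Superadditive.update_sub_one {S : ℕ → ℕ} {n : ℕ} (hS : Superadditive S) (hn : n ≠ 0)
    (h : ∀ i j, 0 < i → 0 < j → i + j = n → S i + S j < S n) :
    Superadditive (Function.update S n (S n - 1)) where
  map_zero := by rw [Function.update_of_ne hn.symm, hS.map_zero]
  add_le i j := by
    have hij := hS.add_le i j
    have hlt := h i j
    grind [Function.update_apply]

theorem IsBinomid.isLexMinExt (he : IsBinomid e) (h : SplitsAfter k (psum e)) :
    IsLexMinExt (fun i : Fin k => e i) e := by
  refine ⟨he, fun _ => rfl, fun e' he' hext => not_lt.1 fun hlt => ?_⟩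
  obtain ⟨n, heq, hlt⟩ := toLex_lt_toLex_iff_psum.1 hlt
  have hkn : k < n + 1 := by
    by_contra! hnk
    exact hlt.ne (forall_psum_eq_iff.2 (fun i hi => hext ⟨i, hi⟩) _ hnk)
  obtain ⟨i, j, hi, hj, hij, split⟩ := h (n + 1) hkn
  refine hlt.not_ge ?_
  calc psum e (n + 1) = psum e' i + psum e' j := by
        rw [split, heq i (by omega), heq j (by omega)]
    _ ≤ psum e' (n + 1) := hij ▸ (isBinomid_iff_superadditive.1 he').add_le i j

/-- If no splitting of `psum e n` were exact, it could be lowered by one, giving a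
lexicographically smaller extension. -/
theorem IsLexMinExt.splitsAfter {μ : Fin k → ℕ} (h : IsLexMinExt μ e) (hk : 0 < k) :
    SplitsAfter k (psum e) := by
  intro n hn
  have hS := isBinomid_iff_superadditive.1 h.1
  by_contra! hne
  have strict (i j : ℕ) (hi : 0 < i) (hj : 0 < j) (hij : i + j = n) :
      psum e i + psum e j < psum e n :=
    (hij ▸ hS.add_le i j).lt_of_ne (hne i j hi hj hij).symm
  obtain ⟨e', he', hpsum⟩ := (hS.update_sub_one (by omega) strict).exists_isBinomid
  have heq (m : ℕ) (hm : m < n) : psum e' m = psum e m := by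
    rw [hpsum, Function.update_of_ne hm.ne]
  have hlt : psum e' n < psum e n := by
    have := strict 1 (n - 1) one_pos (by omega) (by omega)
    rw [hpsum, Function.update_self]
    omega
  have hext : Extends e' μ := fun i =>
    (forall_psum_eq_iff.1 (fun m hm => heq m (by omega)) i i.2).trans (h.2.1 i)
  obtain ⟨m, rfl⟩ := Nat.exists_eq_succ_of_ne_zero (show n ≠ 0 by omega)
  exact (h.2.2 e' he' hext).not_gt
    (toLex_lt_toLex_iff_psum.2 ⟨m, fun i hi => heq i (by omega), hlt⟩)

theorem mem_range_L_iff (hk : 0 < k) :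
    e ∈ Set.range (L k) ↔ IsBinomid e ∧ SplitsAfter k (psum e) := by
  constructor
  · rintro ⟨μ, rfl⟩
    exact ⟨(L_spec k μ).1, (L_spec k μ).splitsAfter hk⟩
  · rintro ⟨he, h⟩
    exact ⟨⟨_, he.restrict k⟩, isLexMinExt_unique (L_spec k _) (he.isLexMinExt h)⟩

theorem monotone_range_L : Monotone fun k : ℕ+ => Set.range (L k) := fun j k hjk e he => by
  rw [mem_range_L_iff (PNat.pos _)] at he ⊢
  exact ⟨he.1, he.2.mono hjk⟩

theorem monotone_spanL : Monotone spanL := fun _ _ hjk =>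
  AddSubmonoid.closure_mono (monotone_range_L hjk)

theorem mem_closure_atom (hk : 0 < k) (he : IsBinomid e) (h : SplitsAfter k (psum e)) :
    e ∈ AddSubmonoid.closure (Atom ∩ Set.range (L k)) := by
  induction hm : psum e k using Nat.strong_induction_on generalizing e with
  | _ m ih =>
    subst hm
    by_cases h0 : e = 0
    · exact h0 ▸ zero_mem _
    by_cases hatom : e ∈ Atom
    · exact AddSubmonoid.subset_closure ⟨hatom, (mem_range_L_iff hk).2 ⟨he, h⟩⟩
    obtain ⟨a, b, ha, hb, ha0, hb0, rfl⟩ := by_contra fun hdec => hatom ⟨he, h0, hdec⟩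
    have psum_pos {x : ℕ → ℕ} (hx : x ≠ 0) (hsplit : SplitsAfter k (psum x)) : 0 < psum x k := by
      refine Nat.pos_of_ne_zero fun hxk => hx (psum_injective ?_)
      rw [map_zero]
      exact hsplit.eq_zero fun n hn => Nat.eq_zero_of_le_zero (hxk ▸ psum_mono x hn)
    have hSa := isBinomid_iff_superadditive.1 ha
    have hSb := isBinomid_iff_superadditive.1 hb
    rw [map_add] at h
    have hsa := h.of_add_left hSa hSb
    have hsb := (add_comm (psum a) _ ▸ h).of_add_left hSb hSa
    have hpa := psum_pos ha0 hsa
    have hpb := psum_pos hb0 hsb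
    have hadd : psum (a + b) k = psum a k + psum b k := by rw [map_add, Pi.add_apply]
    exact add_mem (ih _ (by omega) ha hsa rfl) (ih _ (by omega) hb hsb rfl)

theorem closure_atom_inter_range_L (k : ℕ+) :
    AddSubmonoid.closure (Atom ∩ Set.range (L k)) = spanL k := by
  refine le_antisymm (AddSubmonoid.closure_mono Set.inter_subset_right) ?_
  refine AddSubmonoid.closure_le.2 fun e he => ?_
  obtain ⟨he, h⟩ := (mem_range_L_iff k.pos).1 he
  exact mem_closure_atom k.pos he h

end LexMinimal

section QuasiperiodicSubmonoid

variable {N d : ℕ}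

/-- The binomid indices whose partial sums are quasi-periodic of period `d` from position `N` on.
Unlike the property of being a lex-minimal extension of length `k`, this one is closed under
addition. -/
def quasiperiodicSubmonoid (N d : ℕ) : AddSubmonoid (ℕ → ℕ) where
  carrier := {e | IsBinomid e ∧ IsQuasiperiodic N d (psum e)}
  zero_mem' := ⟨isBinomid_zero, fun _ _ => by simp⟩
  add_mem' ha hb := ⟨ha.1.add hb.1, by rw [map_add]; exact ha.2.add hb.2⟩

theorem spanL_le_quasiperiodicSubmonoid (k : ℕ+) :
    spanL k ≤ quasiperiodicSubmonoid (k * k) (k : ℕ).factorial := by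
  refine AddSubmonoid.closure_le.2 fun e he => ?_
  obtain ⟨he, h⟩ := (mem_range_L_iff k.pos).1 he
  exact ⟨he, (isBinomid_iff_superadditive.1 he).isQuasiperiodic_factorial k.pos h⟩

theorem quasiperiodicSubmonoid_subset_range_L (hd : 0 < d) :
    (quasiperiodicSubmonoid N d : Set (ℕ → ℕ)) ⊆ Set.range (L (N + d)) := fun _ he =>
  (mem_range_L_iff (by omega)).2 ⟨he.1, he.2.splitsAfter hd⟩

theorem iUnion_spanL_eq_lexMin : ⋃ k, (spanL k : Set (ℕ → ℕ)) = LexMin := by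
  refine Set.Subset.antisymm (Set.iUnion_subset fun k e he => ?_) ?_
  · obtain ⟨μ, hμ⟩ := quasiperiodicSubmonoid_subset_range_L (Nat.factorial_pos k)
      (spanL_le_quasiperiodicSubmonoid k he)
    exact ⟨⟨k * k + (k : ℕ).factorial, by positivity⟩, μ, hμ.symm⟩
  · rintro _ ⟨k, μ, rfl⟩
    exact Set.mem_iUnion.2 ⟨k, AddSubmonoid.subset_closure ⟨μ, rfl⟩⟩

theorem coe_iSup_spanL :
    ((⨆ k, spanL k : AddSubmonoid (ℕ → ℕ)) : Set (ℕ → ℕ)) = ⋃ k, (spanL k : Set (ℕ → ℕ)) :=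
  AddSubmonoid.coe_iSup_of_directed monotone_spanL.directed_le

end QuasiperiodicSubmonoid

section Finiteness

variable {a b : ℕ → ℕ} {N d : ℕ}

/-- Divisibility in the monoid of binomid indices, written additively. -/
def IsSummand (a b : ℕ → ℕ) : Prop :=
  ∃ x, IsBinomid x ∧ a + x = b

theorem isAntichain_atom : IsAntichain IsSummand Atom := by
  rintro a ha b hb hab ⟨x, hx, rfl⟩
  refine hb.2.2 ⟨a, x, ha.1, hx, ha.2.1, ?_, rfl⟩
  rintro rfl
  exact hab (add_zero a).symm

/-- By how much `psum a` fails to be additive at `(i, j)`; the truncated subtraction is exact when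
`a` is a binomid index. -/
def defect (a : ℕ → ℕ) (i j : ℕ) : ℕ :=
  psum a (i + j) - (psum a i + psum a j)

theorem IsBinomid.psum_add (ha : IsBinomid a) (i j : ℕ) :
    psum a (i + j) = psum a i + psum a j + defect a i j :=
  (Nat.add_sub_cancel' ((isBinomid_iff_superadditive.1 ha).add_le i j)).symm

theorem defect_comm (a : ℕ → ℕ) (i j : ℕ) : defect a i j = defect a j i := by
  rw [defect, defect, add_comm i, add_comm (psum a i)]

theorem IsQuasiperiodic.defect_add_period (h : IsQuasiperiodic N d (psum a)) {i : ℕ}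
    (hi : N ≤ i) (j : ℕ) : defect a (i + d) j = defect a i j := by
  rw [defect, defect, add_right_comm i, h i hi, h (i + j) (by omega)]
  omega

theorem exists_lt_forall_defect_eq (hd : 0 < d) (i : ℕ) : ∃ i' < N + d,
    ∀ a ∈ quasiperiodicSubmonoid N d, ∀ j, defect a i j = defect a i' j := by
  induction i using Nat.strong_induction_on with
  | _ i ih =>
    by_cases hi : i < N + d
    · exact ⟨i, hi, fun _ _ _ => rfl⟩
    obtain ⟨i₀, rfl⟩ := Nat.exists_eq_add_of_le' (show d ≤ i by omega)
    obtain ⟨i', hi', heq⟩ := ih i₀ (by omega)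
    exact ⟨i', hi', fun a ha j => (ha.2.defect_add_period (by omega) j).trans (heq a ha j)⟩

theorem isSummand_of_defect_le (ha : IsBinomid a) (hb : IsBinomid b) (h0 : a 0 ≤ b 0)
    (hdefect : ∀ i j, defect a i j ≤ defect b i j) : IsSummand a b := by
  have entry_eq {e : ℕ → ℕ} (he : IsBinomid e) (n : ℕ) : e n = e 0 + defect e n 1 := by
    have h1 : psum e 1 = e 0 := Finset.sum_range_one e
    have := he.psum_add n 1
    rw [psum_succ] at this
    omega
  have hle : a ≤ b := fun n => by
    rw [entry_eq ha, entry_eq hb]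
    exact add_le_add h0 (hdefect n 1)
  obtain ⟨x, rfl⟩ := exists_add_of_le hle
  refine ⟨x, isBinomid_iff_superadditive.2 ⟨psum_zero_right x, fun i j => ?_⟩, rfl⟩
  have hai := ha.psum_add i j
  have hbi := hb.psum_add i j
  have hij := hdefect i j
  simp only [map_add, Pi.add_apply] at hbi
  omega

/-- Dickson's lemma, applied to the first entry and the finitely many defects that determine an
element of the submonoid. -/
theorem partiallyWellOrderedOn_quasiperiodicSubmonoid (N : ℕ) (hd : 0 < d) :
    (quasiperiodicSubmonoid N d : Set (ℕ → ℕ)).PartiallyWellOrderedOn IsSummand := by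
  let coords (a : ℕ → ℕ) : ℕ × (Fin (N + d) × Fin (N + d) → ℕ) :=
    (a 0, fun p => defect a p.1 p.2)
  intro f
  obtain ⟨m, n, hmn, h0, hdefect⟩ := wellQuasiOrdered_le fun m => coords (f m)
  refine ⟨m, n, hmn, isSummand_of_defect_le (f m).2.1 (f n).2.1 h0 fun i j => ?_⟩
  obtain ⟨i', hi', hi⟩ := exists_lt_forall_defect_eq (N := N) hd i
  obtain ⟨j', hj', hj⟩ := exists_lt_forall_defect_eq (N := N) hd j
  have reduce {a : ℕ → ℕ} (ha : a ∈ quasiperiodicSubmonoid N d) :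
      defect a i j = defect a i' j' := by
    rw [hi a ha, defect_comm, hj a ha, defect_comm]
  rw [reduce (f m).2, reduce (f n).2]
  exact hdefect (⟨i', hi'⟩, ⟨j', hj'⟩)

theorem finite_atom_inter_quasiperiodicSubmonoid (N : ℕ) (hd : 0 < d) :
    (Atom ∩ quasiperiodicSubmonoid N d).Finite :=
  (isAntichain_atom.subset Set.inter_subset_left).finite_of_partiallyWellOrderedOn
    ((partiallyWellOrderedOn_quasiperiodicSubmonoid N hd).mono Set.inter_subset_right)

theorem spanL_fg (k : ℕ+) : (spanL k).FG := by
  have hfin : (Atom ∩ Set.range (L k)).Finite :=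
    (finite_atom_inter_quasiperiodicSubmonoid (k * k) (Nat.factorial_pos k)).subset
      (Set.inter_subset_inter_right _
        (AddSubmonoid.subset_closure.trans (spanL_le_quasiperiodicSubmonoid k)))
  exact (AddSubmonoid.fg_iff _).2 ⟨_, closure_atom_inter_range_L k, hfin⟩

end Finiteness

end Binomid

theorem mainTheorem7 :
    (∃ T : AddSubmonoid (ℕ → ℕ), (T : Set (ℕ → ℕ)) = Binomid.LexMin ∧
      (T : Set (ℕ → ℕ)) = ⋃ k : ℕ+, (Binomid.spanL k : Set (ℕ → ℕ)) ∧
      Binomid.IsInductiveLimit.{u} Binomid.spanL T) ∧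
    Monotone Binomid.spanL ∧
    (∀ k : ℕ+, Binomid.IsFinitelyPresented (Binomid.spanL k)) ∧
    Monotone (fun k : ℕ+ => Binomid.Atom ∩ Set.range (Binomid.L k)) ∧
    ∀ k : ℕ+, AddSubmonoid.closure (Binomid.Atom ∩ Set.range (Binomid.L k)) = Binomid.spanL k := by
  refine ⟨⟨⨆ k, Binomid.spanL k, ?_, Binomid.coe_iSup_spanL,
    Binomid.isInductiveLimit_iSup Binomid.monotone_spanL⟩, Binomid.monotone_spanL, fun k => ?_,
    fun _ _ hjk => Set.inter_subset_inter_right _ (Binomid.monotone_range_L hjk),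
    Binomid.closure_atom_inter_range_L⟩
  · rw [Binomid.coe_iSup_spanL, Binomid.iUnion_spanL_eq_lexMin]
  · have : AddMonoid.FG (Binomid.spanL k) :=
      (AddMonoid.fg_iff_addSubmonoid_fg _).2 (Binomid.spanL_fg k)
    exact Binomid.isFinitelyPresented_of_fg _
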